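/- Let $\alpha>0$ and $\beta\in(0,1)$. Let $\mathfrak M_+(\mathbb R)$ be the space of Radon point measures on $\mathbb R$ and $\widetilde{\mathbb P}$ the law on it of a Poisson random measure with intensity the Lebesgue measure. Let $\{(\Gamma_\ell,x_\ell,\widetilde{\mathcal N}_\ell)\}_{\ell\in\mathbb N}$ be a measurable enumeration of the points of a Poisson point process on $(0,\infty)\times(0,\infty)\times\mathfrak M_+(\mathbb R)$ with intensity $d\gamma\times\Gamma(1-\beta)^{-1}\beta x^{-\beta-1}dx\times d\widetilde{\mathbb P}$. The Karlin random sup-measure $\mathcal M_{\alpha,\beta}$ is defined by $$\mathcal M_{\alpha,\beta}(G)=\sup_{\ell\in\mathbb N}\Gamma_\ell^{-1/\alpha}\,\mathbf 1\{\widetilde{\mathcal N}_\ell(x_\ell G)\neq 0\}\quad(G\subset\mathbb R\text{ open}),\qquad \mathcal M_{\alpha,\beta}(A)=\inf\{\mathcal M_{\alpha,\beta}(G): G\supset A,\ G\text{ open}\}\quad(A\subset\mathbb R).$$ Let $\zeta(t)=\mathcal M_{\alpha,\beta}((t-1,t])$, $t\in\mathbb R$, be its max-increment process. Then $\zeta$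 is a stationary process and it is not ergodic: there is a measurable set of paths (for the product $\sigma$-algebra on path space) such that the event that $\zeta$ lies in it is invariant under every time shift up to null sets, and this event has probability strictly between $0$ and $1$. Moreover, with $\tau_z(t)=\log\mathbb P(\zeta(0)\le z,\zeta(t)\le z)-2\log\mathbb P(\zeta(0)\le z)$, for every $z>0$ one has $\tau_z(t)=(2-2^\beta)z^{-\alpha}$ for all $t>1$, and $$\lim_{T\to\infty}\frac1T\int_0^T\tau_z(t)\,dt=(2-2^\beta)z^{-\alpha}\neq 0.$$ -/

import Mathlib

open MeasureTheory ProbabilityTheory Filter Topology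
open scoped ENNReal NNReal

noncomputable section

/-- The space of Radon point measures on `ℝ`: locally finite Borel measures with values in
`{0, 1, 2, …, ∞}`.  As a subtype of `Measure ℝ` it carries the σ-algebra generated by the
evaluations `m ↦ m B`, `B` Borel. -/
abbrev RadonPointMeasure : Type :=
  {m : Measure ℝ // IsLocallyFiniteMeasure m ∧
    ∀ B : Set ℝ, MeasurableSet B → ∃ n : ℕ∞, m B = (n : ℝ≥0∞)}

/-- `ξ` is, under `P`, a Poisson random measure on `E` with intensity `μ`: the number `ξ B` of
points in `B` is Poisson with mean `μ B` (almost surely infinite if `μ B = ∞`), and the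
numbers of points in finitely many disjoint sets are independent. -/
structure IsPoissonRandomMeasure {Ω E : Type*} [MeasurableSpace Ω] [MeasurableSpace E]
    (ξ : Ω → Measure E) (μ : Measure E) (P : Measure Ω) : Prop where
  measurable : ∀ B : Set E, MeasurableSet B → Measurable (fun ω => ξ ω B)
  law_finite : ∀ B : Set E, MeasurableSet B → μ B ≠ ∞ →
    P.map (fun ω => ξ ω B) =
      (poissonMeasure (μ B).toNNReal).map (fun n : ℕ => (n : ℝ≥0∞))
  law_infinite : ∀ B : Set E, MeasurableSet B → μ B = ∞ → ∀ᵐ ω ∂P, ξ ω B = ∞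
  indep : ∀ (n : ℕ) (B : Fin n → Set E), (∀ i, MeasurableSet (B i)) →
    Pairwise (fun i j => Disjoint (B i) (B j)) →
    iIndepFun (fun (i : Fin n) (ω : Ω) => ξ ω (B i)) P

/-- `p` is a measurable enumeration of the points of a Poisson point process on `E` with
intensity `μ`. -/
structure IsPoissonPointProcess {Ω E : Type*} [MeasurableSpace Ω] [MeasurableSpace E]
    (p : ℕ → Ω → E) (μ : Measure E) (P : Measure Ω) : Prop where
  measurable : ∀ l, Measurable (p l)
  poisson : IsPoissonRandomMeasure (fun ω => Measure.sum fun l => Measure.dirac (p l ω)) μ P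

/-- `Q` is the law, on the space of Radon point measures, of a standard Poisson random measure
on `ℝ` (intensity: Lebesgue measure). -/
def IsStandardPoissonLaw (Q : Measure RadonPointMeasure) : Prop :=
  IsProbabilityMeasure Q ∧
    IsPoissonRandomMeasure (fun N : RadonPointMeasure => (N : Measure ℝ)) volume Q

/-- The intensity `dγ × Γ(1-β)⁻¹ β x^(-β-1) dx × dQ` on `(0,∞) × (0,∞) × 𝔐₊(ℝ)`, as a measure
on `ℝ × ℝ × 𝔐₊(ℝ)` that does not charge the complement. -/
def karlinIntensity (β : ℝ) (Q : Measure RadonPointMeasure) :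
    Measure (ℝ × ℝ × RadonPointMeasure) :=
  (volume.restrict (Set.Ioi (0 : ℝ))).prod
    (((volume.restrict (Set.Ioi (0 : ℝ))).withDensity
      (fun x => ENNReal.ofReal ((Real.Gamma (1 - β))⁻¹ * (β * x ^ (-β - 1))))).prod Q)

open Classical in
/-- `G ↦ sup_l Γ_l^(-1/α) 1{N_l(x_l G) ≠ 0}` for open `G`, from the points
`q l = (Γ_l, x_l, N_l)`. -/
def karlinOpen (α : ℝ) (q : ℕ → ℝ × ℝ × RadonPointMeasure) (G : Set ℝ) : ℝ≥0∞ :=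
  ⨆ l : ℕ, if ((q l).2.2 : Measure ℝ) ((fun y => (q l).2.1 * y) '' G) ≠ 0
    then ENNReal.ofReal (1 / (q l).1 ^ (1 / α)) else 0

/-- The canonical extension of a sup-measure from the open sets to all sets. -/
def supMeasureExtension (m : Set ℝ → ℝ≥0∞) (A : Set ℝ) : ℝ≥0∞ :=
  ⨅ (G : Set ℝ) (_ : IsOpen G) (_ : A ⊆ G), m G

/-- The Karlin random sup-measure `M_{α,β}` built on the random points `p` (the parameter `β`
enters through the intensity of `p`). -/
def karlinSupMeasure {Ω : Type*} (α : ℝ) (p : ℕ → Ω → ℝ × ℝ × RadonPointMeasure)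
    (A : Set ℝ) (ω : Ω) : ℝ≥0∞ :=
  supMeasureExtension (karlinOpen α (fun l => p l ω)) A

/-- The max-increment process `t ↦ M((t-1, t])` of a random sup-measure `M`. -/
def maxIncrement {Ω : Type*} (M : Set ℝ → Ω → ℝ≥0∞) (t : ℝ) (ω : Ω) : ℝ≥0∞ :=
  M (Set.Ioc (t - 1) t) ω

/-- Strict stationarity: all time shifts of `X` have the same law on path space (with the
product σ-algebra) as `X`. -/
def IsStationaryProcess {Ω S : Type*} [MeasurableSpace Ω] [MeasurableSpace S]
    (X : ℝ → Ω → S) (P : Measure Ω) : Prop :=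
  ∀ h : ℝ, IdentDistrib (fun ω (t : ℝ) => X (t + h) ω) (fun ω (t : ℝ) => X t ω) P P

/-- Ergodicity of a (stationary) process: an event of the path space (with the product
σ-algebra) that is invariant under every time shift up to null sets has probability 0 or 1.
(Invariance has to be understood up to null sets: for an uncountable time set the product
σ-algebra has no strictly invariant events besides the empty set and the whole space.) -/
def IsErgodicProcess {Ω S : Type*} [MeasurableSpace Ω] [MeasurableSpace S]
    (X : ℝ → Ω → S) (P : Measure Ω) : Prop :=
  ∀ A : Set (ℝ → S), MeasurableSet A →
    (∀ h : ℝ, P (symmDiff {ω | (fun t => X (t + h) ω) ∈ A} {ω | (fun t => X t ω) ∈ A}) = 0) →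
    P {ω | (fun t => X t ω) ∈ A} = 0 ∨ P {ω | (fun t => X t ω) ∈ A} = 1

/-- `τ_z(t) = log P(X(0) ≤ z, X(t) ≤ z) - 2 log P(X(0) ≤ z)`. -/
def bivariateDependence {Ω : Type*} [MeasurableSpace Ω] (X : ℝ → Ω → ℝ≥0∞) (P : Measure Ω)
    (z t : ℝ) : ℝ :=
  Real.log (P.real {ω | X 0 ω ≤ ENNReal.ofReal z ∧ X t ω ≤ ENNReal.ofReal z}) -
    2 * Real.log (P.real {ω | X 0 ω ≤ ENNReal.ofReal z})

end

/-! The increments over intervals `I i` stay below levels `z i` exactly when no point `(γ, x, N)`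
has, for some `i`, a mark `γ ^ (-1/α) > z i` and a measure `N` charging `x I i`. This is a void
probability, so it equals `exp (-Λ)` with `Λ` the intensity of such points. A standard Poisson `N`
charges `x V` with probability `1 - exp (-x |V|)`, and integrating this against the normalised
density in `x` gives `|V| ^ β`. Hence `Λ` is the integral over `γ` of the `β`-th power of the length
of the union of those `I i` with `z i < γ ^ (-1/α)` (`karlinIntensity_karlinHitSet`). Translation
invariance of length gives stationarity.

For a common level `z`, `Λ = |⋃ I i| ^ β * z ^ (-α)`, which yields `τ_z` explicitly. Since two unit
intervals cover length at most `2`, the events `ζ(s) ≤ 1`, `ζ(t) ≤ 1` have joint probability at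
least `exp (-2 ^ β) > exp (-2)`, the square of the marginal probability, however far apart `s` and
`t` are. In `L²` of path space, the closed convex hull of the indicators of these events contains a
shift-invariant element, its point of least norm. Its squared norm is at least `exp (-2 ^ β)` and
its mean is `exp (-1)`, so it is not constant, contrary to ergodicity
(`IsStationaryProcess.not_ergodic_of_le_correlation`). -/

/-- The probability that a Poisson variable with mean `v ∈ [0, ∞]` vanishes. -/
noncomputable def expNeg (v : ℝ≥0∞) : ℝ≥0∞ :=
  if v = ∞ then 0 else ENNReal.ofReal (Real.exp (-v.toReal))

lemma expNeg_ofReal {v : ℝ} (hv : 0 ≤ v) :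
    expNeg (ENNReal.ofReal v) = ENNReal.ofReal (Real.exp (-v)) := by
  simp [expNeg, ENNReal.toReal_ofReal hv]

lemma expNeg_zero : expNeg 0 = 1 := by simp [expNeg]

/-! ### Void probabilities and finiteness for Poisson processes -/

namespace IsPoissonRandomMeasure

variable {Ω E : Type*} [MeasurableSpace Ω] [MeasurableSpace E] {ξ : Ω → Measure E}
  {μ : Measure E} {P : Measure Ω}

/-- Void probabilities of a Poisson random measure. -/
lemma measure_eq_zero (h : IsPoissonRandomMeasure ξ μ P) {B : Set E} (hB : MeasurableSet B) :
    P {ω | ξ ω B = 0} = expNeg (μ B) := by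
  by_cases hμ : μ B = ∞
  · rw [expNeg, if_pos hμ, measure_eq_zero_iff_ae_notMem]
    filter_upwards [h.law_infinite B hB hμ] with ω hω
    simp [hω]
  · have h1 := congrArg (fun ν => ν {0}) (h.law_finite B hB hμ)
    rw [Measure.map_apply (h.measurable B hB) (measurableSet_singleton 0),
      Measure.map_apply (by fun_prop) (measurableSet_singleton 0)] at h1
    have h2 : (fun n : ℕ => (n : ℝ≥0∞)) ⁻¹' {0} = {0} := by ext; simp
    rw [h2, poissonMeasure_singleton] at h1
    rw [expNeg, if_neg hμ, show {ω | ξ ω B = 0} = (fun ω => ξ ω B) ⁻¹' {0} by ext; simp]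
    simpa [ENNReal.coe_toNNReal_eq_toReal] using h1

lemma ae_lt_top (h : IsPoissonRandomMeasure ξ μ P) {B : Set E} (hB : MeasurableSet B)
    (hμ : μ B ≠ ∞) : ∀ᵐ ω ∂P, ξ ω B ≠ ∞ := by
  have h1 := congrArg (fun ν => ν {∞}) (h.law_finite B hB hμ)
  rw [Measure.map_apply (h.measurable B hB) (measurableSet_singleton _),
    Measure.map_apply (by fun_prop) (measurableSet_singleton _)] at h1
  have h2 : (fun n : ℕ => (n : ℝ≥0∞)) ⁻¹' {∞} = ∅ := by ext; simp
  rw [h2, measure_empty, measure_eq_zero_iff_ae_notMem] at h1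
  exact h1

end IsPoissonRandomMeasure

namespace IsPoissonPointProcess

variable {Ω E : Type*} [MeasurableSpace Ω] [MeasurableSpace E] {p : ℕ → Ω → E}
  {μ : Measure E} {P : Measure Ω}

lemma sum_dirac_eq_zero_iff {q : ℕ → E} {B : Set E} (hB : MeasurableSet B) :
    (Measure.sum fun l => Measure.dirac (q l)) B = 0 ↔ ∀ l, q l ∉ B := by
  rw [Measure.sum_apply _ hB, ENNReal.tsum_eq_zero]
  refine forall_congr' fun l => ?_
  rw [Measure.dirac_apply' _ hB]
  simp

lemma finite_of_sum_dirac_ne_top {q : ℕ → E} {B : Set E} (hB : MeasurableSet B)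
    (h : (Measure.sum fun l => Measure.dirac (q l)) B ≠ ∞) : {l | q l ∈ B}.Finite := by
  rw [Measure.sum_apply _ hB] at h
  refine (ENNReal.finite_const_le_of_tsum_ne_top h one_ne_zero).subset fun l hl => ?_
  simp only [Set.mem_ofPred_eq] at hl ⊢
  rw [Measure.dirac_apply' _ hB]
  simp [hl]

/-- The probability that no point falls into a set. -/
lemma measure_forall_notMem (h : IsPoissonPointProcess p μ P) {B : Set E}
    (hB : MeasurableSet B) : P {ω | ∀ l, p l ω ∉ B} = expNeg (μ B) := by
  rw [← h.poisson.measure_eq_zero hB]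
  congr 1
  ext ω
  exact (sum_dirac_eq_zero_iff hB).symm

lemma ae_finite (h : IsPoissonPointProcess p μ P) {B : Set E} (hB : MeasurableSet B)
    (hμ : μ B ≠ ∞) : ∀ᵐ ω ∂P, {l | p l ω ∈ B}.Finite := by
  filter_upwards [h.poisson.ae_lt_top hB hμ] with ω hω
  exact finite_of_sum_dirac_ne_top hB hω

lemma ae_forall_notMem [IsProbabilityMeasure P] (h : IsPoissonPointProcess p μ P) {B : Set E}
    (hB : MeasurableSet B) (hμ : μ B = 0) : ∀ᵐ ω ∂P, ∀ l, p l ω ∉ B := by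
  have hm : MeasurableSet {ω | ∀ l, p l ω ∉ B} := by
    rw [Set.ofPred_forall]
    exact MeasurableSet.iInter fun l => (h.measurable l hB).compl
  have := h.measure_forall_notMem hB
  rw [hμ, expNeg_zero, ← mem_ae_iff_prob_eq_one hm] at this
  exact this

end IsPoissonPointProcess

/-! ### Continuity of point measures on intervals -/

namespace RadonPointMeasure

variable (m : RadonPointMeasure)

/-- Masses are integers, so nonzero masses of the shrinking intervals are at least `1`, a bound that
survives continuity from above. -/
lemma Ioc_ne_zero_iff {a b : ℝ} {u : ℕ → ℝ} (hu : Antitone u) (hb : ∀ n, b < u n)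
    (hlim : Tendsto u atTop (𝓝 b)) :
    (m : Measure ℝ) (Set.Ioc a b) ≠ 0 ↔ ∀ n, (m : Measure ℝ) (Set.Ioo a (u n)) ≠ 0 := by
  have := m.2.1
  constructor
  · intro h n h0
    exact h (measure_mono_null (Set.Ioc_subset_Ioo_right (hb n)) h0)
  · intro h
    have hI : ⋂ n, Set.Ioo a (u n) = Set.Ioc a b := by
      ext y
      simp only [Set.mem_iInter, Set.mem_Ioo, Set.mem_Ioc]
      refine ⟨fun hy => ⟨(hy 0).1, ge_of_tendsto' hlim fun n => (hy n).2.le⟩,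
        fun hy n => ⟨hy.1, hy.2.trans_lt (hb n)⟩⟩
    have ht := tendsto_measure_iInter_atTop (μ := (m : Measure ℝ))
      (s := fun n => Set.Ioo a (u n)) (fun n => measurableSet_Ioo.nullMeasurableSet)
      (fun i j hij => Set.Ioo_subset_Ioo_right (hu hij)) ⟨0, measure_Ioo_lt_top.ne⟩
    rw [hI] at ht
    have h1 : (1 : ℝ≥0∞) ≤ (m : Measure ℝ) (Set.Ioc a b) := by
      refine ge_of_tendsto' ht fun n => ?_
      obtain ⟨k, hk⟩ := m.2.2 _ (measurableSet_Ioo (a := a) (b := u n))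
      have hn := h n
      rw [Function.comp_apply]
      rw [hk] at hn ⊢
      have : k ≠ 0 := by rintro rfl; simp at hn
      exact_mod_cast Order.one_le_iff_pos.2 (pos_iff_ne_zero.2 this)
    exact (zero_lt_one.trans_le h1).ne'

/-- Rational endpoints separate the dependence on the scale from that on the point measure, which
makes the hitting condition jointly measurable. -/
lemma Ioo_ne_zero_iff {a b : ℝ} :
    (m : Measure ℝ) (Set.Ioo a b) ≠ 0 ↔
      ∃ c d : ℚ, a < c ∧ (d : ℝ) < b ∧ (m : Measure ℝ) (Set.Ioo (c : ℝ) d) ≠ 0 := by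
  constructor
  · intro h
    by_contra! hcd
    refine h (measure_mono_null (t := ⋃ c : ℚ, ⋃ d : ℚ, ⋃ (_ : a < c ∧ (d : ℝ) < b),
      Set.Ioo (c : ℝ) d) ?_ ?_)
    · intro y hy
      obtain ⟨c, hc⟩ := exists_rat_btwn hy.1
      obtain ⟨d, hd⟩ := exists_rat_btwn hy.2
      simp only [Set.mem_iUnion]
      exact ⟨c, d, ⟨hc.1, hd.2⟩, hc.2, hd.1⟩
    · simp only [measure_iUnion_null_iff]
      exact fun c d h => hcd c d h.1 h.2
  · rintro ⟨c, d, hc, hd, h⟩ h0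
    exact h (measure_mono_null (Set.Ioo_subset_Ioo hc.le hd.le) h0)

lemma measurable_apply {B : Set ℝ} (hB : MeasurableSet B) :
    Measurable fun m : RadonPointMeasure => (m : Measure ℝ) B :=
  (Measure.measurable_coe hB).comp measurable_subtype_coe

lemma tendsto_add_inv (b : ℝ) : Tendsto (fun n : ℕ => b + 1 / ((n : ℝ) + 1)) atTop (𝓝 b) := by
  simpa using tendsto_one_div_add_atTop_nhds_zero_nat.const_add b

lemma antitone_add_inv (b : ℝ) : Antitone (fun n : ℕ => b + 1 / ((n : ℝ) + 1)) := by
  intro i j hij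
  have : (i : ℝ) ≤ j := by exact_mod_cast hij
  dsimp only
  gcongr

lemma image_Ioc_ne_zero_iff {x : ℝ} (hx : 0 < x) (a b : ℝ) :
    (m : Measure ℝ) ((fun y => x * y) '' Set.Ioc a b) ≠ 0 ↔
      ∀ n : ℕ, (m : Measure ℝ) ((fun y => x * y) '' Set.Ioo a (b + 1 / ((n : ℝ) + 1))) ≠ 0 := by
  simp only [Set.image_mul_left_Ioc hx, Set.image_mul_left_Ioo hx]
  refine m.Ioc_ne_zero_iff (fun i j hij => ?_) (fun n => ?_) ((tendsto_add_inv b).const_mul x)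
  · exact mul_le_mul_of_nonneg_left (antitone_add_inv b hij) hx.le
  · gcongr
    linarith [show (0 : ℝ) < 1 / ((n : ℝ) + 1) by positivity]

lemma measurableSet_image_Ioo_ne_zero (a b : ℝ) :
    MeasurableSet {q : ℝ × RadonPointMeasure | 0 < q.1 ∧
      (q.2 : Measure ℝ) ((fun y => q.1 * y) '' Set.Ioo a b) ≠ 0} := by
  have : {q : ℝ × RadonPointMeasure | 0 < q.1 ∧
      (q.2 : Measure ℝ) ((fun y => q.1 * y) '' Set.Ioo a b) ≠ 0} =
      {q | 0 < q.1} ∩ ⋃ c : ℚ, ⋃ d : ℚ, ({q | q.1 * a < c} ∩ {q | (d : ℝ) < q.1 * b} ∩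
        {q | (q.2 : Measure ℝ) (Set.Ioo (c : ℝ) d) ≠ 0}) := by
    ext q
    simp only [Set.mem_ofPred_eq, Set.mem_inter_iff, Set.mem_iUnion]
    refine and_congr_right fun hq => ?_
    rw [Set.image_mul_left_Ioo hq, Ioo_ne_zero_iff]
    simp only [and_assoc]
  rw [this]
  refine (measurableSet_lt measurable_const measurable_fst).inter
    (MeasurableSet.iUnion fun c => MeasurableSet.iUnion fun d => ?_)
  refine ((measurableSet_lt (by fun_prop) (by fun_prop)).inter
    (measurableSet_lt (by fun_prop) (by fun_prop))).inter ?_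
  exact (((measurable_apply measurableSet_Ioo).comp measurable_snd)
    (measurableSet_singleton 0)).compl

lemma measurableSet_image_Ioc_ne_zero (a b : ℝ) :
    MeasurableSet {q : ℝ × RadonPointMeasure | 0 < q.1 ∧
      (q.2 : Measure ℝ) ((fun y => q.1 * y) '' Set.Ioc a b) ≠ 0} := by
  have : {q : ℝ × RadonPointMeasure | 0 < q.1 ∧
      (q.2 : Measure ℝ) ((fun y => q.1 * y) '' Set.Ioc a b) ≠ 0} =
      ⋂ n : ℕ, {q | 0 < q.1 ∧ (q.2 : Measure ℝ)
        ((fun y => q.1 * y) '' Set.Ioo a (b + 1 / ((n : ℝ) + 1))) ≠ 0} := by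
    ext q
    simp only [Set.mem_ofPred_eq, Set.mem_iInter, forall_and, forall_const]
    exact and_congr_right fun hq => q.2.image_Ioc_ne_zero_iff hq a b
  rw [this]
  exact MeasurableSet.iInter fun n => measurableSet_image_Ioo_ne_zero _ _

end RadonPointMeasure

/-! ### The intensity of the points that hit a set -/

lemma lintegral_exp_neg_mul_Ioo {w x : ℝ} (hw : 0 ≤ w) (hx : 0 < x) :
    ∫⁻ y in Set.Ioo 0 x, ENNReal.ofReal (w * Real.exp (-(w * y))) =
      ENNReal.ofReal (1 - Real.exp (-(x * w))) := by
  have hc : Continuous fun y : ℝ => w * Real.exp (-(w * y)) := by fun_prop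
  rw [← ofReal_integral_eq_lintegral_ofReal
    ((hc.integrableOn_Icc (a := 0) (b := x)).mono_set Set.Ioo_subset_Icc_self)
    (ae_of_all _ fun y => by positivity), ← integral_Ioc_eq_integral_Ioo,
    ← intervalIntegral.integral_of_le hx.le]
  congr 1
  rw [intervalIntegral.integral_eq_sub_of_hasDerivAt (f := fun y => -Real.exp (-(w * y)))
    (fun y _ => ?_) (hc.intervalIntegrable _ _)]
  · simp only [mul_comm x w, mul_zero, neg_zero, Real.exp_zero]; ring
  · have : HasDerivAt (fun y => -Real.exp (-(w * y))) (-(Real.exp (-(w * y)) * -(w * 1))) y :=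
      (((hasDerivAt_id y).const_mul w).neg.exp).neg
    exact this.congr_deriv (by ring)

lemma lintegral_mul_rpow_Ioi {β y : ℝ} (hβ : 0 < β) (hy : 0 < y) :
    ∫⁻ x in Set.Ioi y, ENNReal.ofReal (β * x ^ (-β - 1)) = ENNReal.ofReal (y ^ (-β)) := by
  rw [← ofReal_integral_eq_lintegral_ofReal
    ((integrableOn_Ioi_rpow_of_lt (by linarith) hy).const_mul β), integral_const_mul,
    integral_Ioi_rpow_of_lt (by linarith) hy]
  · congr 1
    rw [sub_add_cancel]
    field_simp
  · filter_upwards [ae_restrict_mem measurableSet_Ioi] with x hx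
    have : 0 < x := hy.trans hx
    positivity

/-- Write `1 - exp (-(x * w))` as the integral of `w * exp (-(w * y))` over `0 < y < x` and swap:
the tail integral in `x` is `y ^ (-β)`, leaving a Gamma integral in `y`. -/
lemma lintegral_rpow_mul_one_sub_exp {β w : ℝ} (hβ0 : 0 < β) (hβ1 : β < 1) (hw : 0 < w) :
    ∫⁻ x in Set.Ioi 0, ENNReal.ofReal (β * x ^ (-β - 1)) *
      ENNReal.ofReal (1 - Real.exp (-(x * w))) =
      ENNReal.ofReal (Real.Gamma (1 - β) * w ^ β) := by
  set f : ℝ → ℝ≥0∞ := fun x => ENNReal.ofReal (β * x ^ (-β - 1)) with hf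
  set g : ℝ → ℝ≥0∞ := fun y => ENNReal.ofReal (w * Real.exp (-(w * y))) with hg
  have hfm : Measurable f := by fun_prop
  have hgm : Measurable g := by fun_prop
  have hS : MeasurableSet {q : ℝ × ℝ | q.2 < q.1} := measurableSet_lt (by fun_prop) (by fun_prop)
  have h1 : ∀ x ∈ Set.Ioi (0 : ℝ), f x * ENNReal.ofReal (1 - Real.exp (-(x * w))) =
      ∫⁻ y in Set.Ioi 0, {q : ℝ × ℝ | q.2 < q.1}.indicator (fun q => f q.1 * g q.2) (x, y) := by
    intro x hx
    rw [← lintegral_exp_neg_mul_Ioo hw.le hx, ← lintegral_const_mul _ hgm,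
      ← Set.Ioi_inter_Iio, Set.inter_comm, ← Measure.restrict_restrict measurableSet_Iio,
      ← lintegral_indicator measurableSet_Iio]
    refine lintegral_congr fun y => ?_
    by_cases hy : y < x <;> simp [hy, Set.indicator]
  have h2 : ∀ y ∈ Set.Ioi (0 : ℝ),
      ∫⁻ x in Set.Ioi 0, {q : ℝ × ℝ | q.2 < q.1}.indicator (fun q => f q.1 * g q.2) (x, y) =
      ENNReal.ofReal (w * (y ^ ((1 - β) - 1) * Real.exp (-(w * y)))) := by
    intro y hy
    have hy' : (0 : ℝ) < y := hy
    have : Set.Ioi y ∩ Set.Ioi 0 = Set.Ioi y := by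
      rw [Set.Ioi_inter_Ioi, sup_eq_left.2 hy'.le]
    rw [show w * (y ^ ((1 - β) - 1) * Real.exp (-(w * y))) =
      y ^ (-β) * (w * Real.exp (-(w * y))) by rw [sub_sub_cancel_left]; ring,
      ENNReal.ofReal_mul (by positivity), ← lintegral_mul_rpow_Ioi hβ0 hy',
      ← lintegral_mul_const _ hfm]
    conv_rhs => rw [← this, ← Measure.restrict_restrict measurableSet_Ioi,
      ← lintegral_indicator measurableSet_Ioi]
    refine lintegral_congr fun x => ?_
    by_cases hx : y < x <;> simp [hx, Set.indicator, f, g]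
  rw [setLIntegral_congr_fun measurableSet_Ioi h1, lintegral_lintegral_swap,
    setLIntegral_congr_fun measurableSet_Ioi h2, ← ofReal_integral_eq_lintegral_ofReal,
    integral_const_mul, Real.integral_rpow_mul_exp_neg_mul_Ioi (by linarith) hw]
  · congr 1
    rw [one_div, Real.inv_rpow hw.le, ← Real.rpow_neg hw.le, neg_sub, Real.rpow_sub_one hw.ne']
    field_simp
  · refine Integrable.const_mul ?_ _
    -- A non-integrable function would have Bochner integral `0`, whereas the Gamma formula gives a
    -- positive value.
    by_contra h
    have h0 := Real.integral_rpow_mul_exp_neg_mul_Ioi (a := 1 - β) (by linarith) hw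
    rw [integral_undef h] at h0
    have : 0 < (1 / w) ^ (1 - β) * Real.Gamma (1 - β) :=
      mul_pos (by positivity) (Real.Gamma_pos_of_pos (by linarith))
    linarith
  · filter_upwards [ae_restrict_mem measurableSet_Ioi] with y hy
    have : (0 : ℝ) < y := hy
    positivity
  · refine Measurable.aemeasurable ?_
    exact Measurable.indicator ((hfm.comp measurable_fst).mul (hgm.comp measurable_snd)) hS

lemma one_sub_expNeg_ofReal {v : ℝ} (hv : 0 ≤ v) :
    1 - expNeg (ENNReal.ofReal v) = ENNReal.ofReal (1 - Real.exp (-v)) := by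
  rw [expNeg_ofReal hv, ENNReal.ofReal_sub _ (Real.exp_nonneg _), ENNReal.ofReal_one]

lemma lintegral_one_sub_expNeg {β : ℝ} (hβ0 : 0 < β) (hβ1 : β < 1) {v : ℝ≥0∞} (hv : v ≠ ∞) :
    ∫⁻ x in Set.Ioi 0, ENNReal.ofReal ((Real.Gamma (1 - β))⁻¹ * (β * x ^ (-β - 1))) *
      (1 - expNeg (ENNReal.ofReal x * v)) = v ^ β := by
  have hΓ : 0 < Real.Gamma (1 - β) := Real.Gamma_pos_of_pos (by linarith)
  lift v to ℝ≥0 using hv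
  rcases eq_or_ne v 0 with rfl | hv0
  · simp [expNeg_zero, hβ0]
  · have hw : (0 : ℝ) < v := by positivity
    have h1 : ∀ x ∈ Set.Ioi (0 : ℝ),
        ENNReal.ofReal ((Real.Gamma (1 - β))⁻¹ * (β * x ^ (-β - 1))) *
          (1 - expNeg (ENNReal.ofReal x * v)) =
        ENNReal.ofReal (Real.Gamma (1 - β))⁻¹ * (ENNReal.ofReal (β * x ^ (-β - 1)) *
          ENNReal.ofReal (1 - Real.exp (-(x * v)))) := by
      intro x hx
      have hx' : (0 : ℝ) < x := hx
      rw [ENNReal.ofReal_mul (by positivity), mul_assoc, ← ENNReal.ofReal_coe_nnreal,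
        ← ENNReal.ofReal_mul hx'.le, one_sub_expNeg_ofReal (by positivity)]
    rw [setLIntegral_congr_fun measurableSet_Ioi h1, lintegral_const_mul _ (by fun_prop),
      lintegral_rpow_mul_one_sub_exp hβ0 hβ1 hw, ← ENNReal.ofReal_mul (by positivity),
      inv_mul_cancel_left₀ hΓ.ne', ENNReal.ofReal_rpow_of_pos hw |>.symm,
      ENNReal.ofReal_coe_nnreal]

/-- The height `γ ^ (-1/α)` of a point of the Karlin sup-measure. -/
noncomputable def karlinMark (α γ : ℝ) : ℝ≥0∞ := ENNReal.ofReal (1 / γ ^ (1 / α))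

@[fun_prop]
lemma measurable_karlinMark (α : ℝ) : Measurable (karlinMark α) := by
  unfold karlinMark; fun_prop

lemma volume_lt_karlinMark {α z : ℝ} (hα : 0 < α) (hz : 0 < z) :
    volume ({γ | ENNReal.ofReal z < karlinMark α γ} ∩ Set.Ioi 0) =
      ENNReal.ofReal (z ^ (-α)) := by
  have : {γ | ENNReal.ofReal z < karlinMark α γ} ∩ Set.Ioi 0 = Set.Ioo 0 (z ^ (-α)) := by
    ext γ
    simp only [Set.mem_inter_iff, Set.mem_ofPred_eq, Set.mem_Ioi, Set.mem_Ioo, and_comm]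
    refine and_congr_left fun hγ => ?_
    have hg : 0 < γ ^ (1 / α) := by positivity
    rw [karlinMark, ENNReal.ofReal_lt_ofReal_iff (by positivity), lt_one_div hz hg,
      Real.rpow_neg hz.le, ← Real.inv_rpow hz.le, ← one_div z, one_div α,
      Real.rpow_inv_lt_iff_of_pos hγ.le (by positivity) hα]
  rw [this, Real.volume_Ioo, sub_zero]

/-- The triples `(γ, x, N)` whose mark exceeds some level `z i` and whose rescaled point measure
charges the corresponding set `J i`. -/
def karlinHitSet {ι : Type*} (α : ℝ) (J : ι → Set ℝ) (z : ι → ℝ≥0∞) :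
    Set (ℝ × ℝ × RadonPointMeasure) :=
  {q | 0 < q.2.1 ∧ ∃ i, z i < karlinMark α q.1 ∧
    (q.2.2 : Measure ℝ) ((fun y => q.2.1 * y) '' J i) ≠ 0}

section

variable {ι : Type*} [Countable ι] {α β : ℝ} {Q : Measure RadonPointMeasure} {J : ι → Set ℝ}
  {z : ι → ℝ≥0∞}

lemma measurableSet_karlinHitSet (hJ : ∀ i, MeasurableSet {q : ℝ × RadonPointMeasure | 0 < q.1 ∧
      (q.2 : Measure ℝ) ((fun y => q.1 * y) '' J i) ≠ 0}) :
    MeasurableSet (karlinHitSet α J z) := by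
  have : karlinHitSet α J z = ⋃ i, {q | z i < karlinMark α q.1} ∩ Prod.snd ⁻¹'
      {q : ℝ × RadonPointMeasure | 0 < q.1 ∧
        (q.2 : Measure ℝ) ((fun y => q.1 * y) '' J i) ≠ 0} := by
    ext q
    simp only [karlinHitSet, Set.mem_ofPred_eq, Set.mem_iUnion, Set.mem_inter_iff,
      Set.mem_preimage]
    grind
  rw [this]
  exact MeasurableSet.iUnion fun i => (measurableSet_lt measurable_const (by fun_prop)).inter
    (measurable_snd (hJ i))

lemma IsStandardPoissonLaw.measure_ne_zero (hQ : IsStandardPoissonLaw Q) {V : Set ℝ}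
    (hV : MeasurableSet V) :
    Q {N | (N : Measure ℝ) V ≠ 0} = 1 - expNeg (volume V) := by
  have := hQ.1
  rw [← hQ.2.measure_eq_zero hV, ← prob_compl_eq_one_sub]
  · rfl
  · exact RadonPointMeasure.measurable_apply hV (measurableSet_singleton 0)

lemma volume_image_mul_left {x : ℝ} (hx : 0 < x) (V : Set ℝ) :
    volume ((fun y => x * y) '' V) = ENNReal.ofReal x * volume V := by
  have := Measure.addHaar_smul (volume : Measure ℝ) x V
  simpa [abs_of_pos hx, ← Set.image_smul] using this

/-- For fixed `γ` and `x`, hitting one of the admissible `J i` is the same as charging the scaled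
union of them, so only the length of this union matters. -/
lemma karlinIntensity_karlinHitSet (hβ0 : 0 < β) (hβ1 : β < 1) (hQ : IsStandardPoissonLaw Q)
    (hJ : ∀ i, MeasurableSet {q : ℝ × RadonPointMeasure | 0 < q.1 ∧
      (q.2 : Measure ℝ) ((fun y => q.1 * y) '' J i) ≠ 0})
    (hJm : ∀ i, MeasurableSet (J i)) (hfin : volume (⋃ i, J i) ≠ ∞) :
    karlinIntensity β Q (karlinHitSet α J z) =
      ∫⁻ γ in Set.Ioi 0, volume (⋃ i, ⋃ (_ : z i < karlinMark α γ), J i) ^ β := by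
  have := hQ.1
  have hB := measurableSet_karlinHitSet (α := α) (z := z) hJ
  rw [karlinIntensity, Measure.prod_apply hB]
  refine lintegral_congr fun γ => ?_
  have hBγ := measurable_prodMk_left (x := γ) hB
  rw [Measure.prod_apply hBγ, lintegral_withDensity_eq_lintegral_mul _ (by fun_prop)
    (measurable_measure_prodMk_left hBγ), ← lintegral_one_sub_expNeg hβ0 hβ1
    (ne_top_of_le_ne_top hfin (measure_mono
      (Set.iUnion_mono fun i => Set.iUnion_subset fun _ => subset_rfl)))]
  refine setLIntegral_congr_fun measurableSet_Ioi fun x hx => ?_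
  have hx' : (0 : ℝ) < x := hx
  have hV : MeasurableSet (⋃ i, ⋃ (_ : z i < karlinMark α γ), J i) :=
    MeasurableSet.iUnion fun i => MeasurableSet.iUnion fun _ => hJm i
  have hV' : MeasurableSet ((fun y => x * y) '' ⋃ i, ⋃ (_ : z i < karlinMark α γ), J i) :=
    (measurableEmbedding_mulLeft₀ hx'.ne').measurableSet_image.2 hV
  rw [Pi.mul_apply, ← volume_image_mul_left hx', ← hQ.measure_ne_zero hV']
  congr 2
  ext N
  simp only [karlinHitSet, Set.mem_preimage, Set.mem_ofPred_eq, hx', true_and, Set.image_iUnion,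
    ne_eq, measure_iUnion_null_iff, not_forall, exists_prop]

/-- With a common level the union is all of `⋃ i, J i` for `γ < r ^ (-α)` and empty otherwise; the
empty case contributes `0 ^ β = 0`. -/
lemma karlinIntensity_karlinHitSet_const (hα : 0 < α) (hβ0 : 0 < β) (hβ1 : β < 1)
    (hQ : IsStandardPoissonLaw Q)
    (hJ : ∀ i, MeasurableSet {q : ℝ × RadonPointMeasure | 0 < q.1 ∧
      (q.2 : Measure ℝ) ((fun y => q.1 * y) '' J i) ≠ 0})
    (hJm : ∀ i, MeasurableSet (J i)) (hfin : volume (⋃ i, J i) ≠ ∞) {r : ℝ} (hr : 0 < r) :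
    karlinIntensity β Q (karlinHitSet α J fun _ => ENNReal.ofReal r) =
      volume (⋃ i, J i) ^ β * ENNReal.ofReal (r ^ (-α)) := by
  rw [karlinIntensity_karlinHitSet hβ0 hβ1 hQ hJ hJm hfin, ← volume_lt_karlinMark hα hr,
    ← setLIntegral_const, ← Measure.restrict_restrict (measurableSet_lt (by fun_prop)
    (by fun_prop)), ← lintegral_indicator (measurableSet_lt (by fun_prop) (by fun_prop))]
  refine lintegral_congr fun γ => ?_
  by_cases h : ENNReal.ofReal r < karlinMark α γ <;> simp [h, Set.indicator, hβ0]

end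

/-! ### Max-increments of the Karlin sup-measure -/

lemma karlinOpen_le_iff {α : ℝ} {q : ℕ → ℝ × ℝ × RadonPointMeasure} {G : Set ℝ} {c : ℝ≥0∞} :
    karlinOpen α q G ≤ c ↔
      ∀ l, ((q l).2.2 : Measure ℝ) ((fun y => (q l).2.1 * y) '' G) ≠ 0 →
        karlinMark α (q l).1 ≤ c := by
  rw [karlinOpen, iSup_le_iff]
  refine forall_congr' fun l => ?_
  split_ifs with h <;> simp [h, karlinMark]

lemma karlinOpen_mono {α : ℝ} {q : ℕ → ℝ × ℝ × RadonPointMeasure} {G H : Set ℝ} (h : G ⊆ H) :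
    karlinOpen α q G ≤ karlinOpen α q H := by
  refine karlinOpen_le_iff.2 fun l hl => karlinOpen_le_iff.1 le_rfl l fun h0 => hl ?_
  exact measure_mono_null (Set.image_mono h) h0

lemma supMeasureExtension_Ioc {m : Set ℝ → ℝ≥0∞} (hm : Monotone m) {a b : ℝ} (hab : a < b) :
    supMeasureExtension m (Set.Ioc a b) = ⨅ n : ℕ, m (Set.Ioo a (b + 1 / ((n : ℝ) + 1))) := by
  refine le_antisymm (le_iInf fun n => ?_) (le_iInf fun G => le_iInf fun hG => le_iInf fun hs => ?_)
  · refine (iInf_le _ (Set.Ioo a (b + 1 / ((n : ℝ) + 1)))).trans ?_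
    refine (iInf_le _ isOpen_Ioo).trans (iInf_le _ (Set.Ioc_subset_Ioo_right ?_))
    linarith [show (0 : ℝ) < 1 / ((n : ℝ) + 1) by positivity]
  · obtain ⟨ε, hε, hball⟩ := Metric.isOpen_iff.1 hG b (hs (Set.right_mem_Ioc.2 hab))
    obtain ⟨n, hn⟩ := exists_nat_one_div_lt hε
    refine (iInf_le _ n).trans (hm fun y hy => ?_)
    rcases le_or_gt y b with h | h
    · exact hs ⟨hy.1, h⟩
    · refine hball ?_
      rw [Metric.mem_ball, Real.dist_eq, abs_lt]
      constructor <;> linarith [hy.2]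

/-- If only finitely many points above any positive level hit a neighbourhood of `(a, b]`, then
the sup-measure of `(a, b]` is the supremum over the points which hit `(a, b]`. -/
lemma supMeasureExtension_karlinOpen_Ioc {α : ℝ} {q : ℕ → ℝ × ℝ × RadonPointMeasure} {a b : ℝ}
    (hab : a < b) (hpos : ∀ l, 0 < (q l).2.1)
    (hfin : ∀ k : ℕ, {l | q l ∈ karlinHitSet α (fun _ : Unit => Set.Ioo a (b + 1))
      (fun _ => ENNReal.ofReal (1 / ((k : ℝ) + 1)))}.Finite) :
    supMeasureExtension (karlinOpen α q) (Set.Ioc a b) = karlinOpen α q (Set.Ioc a b) := by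
  rw [supMeasureExtension_Ioc (fun _ _ h => karlinOpen_mono h) hab]
  refine le_antisymm (le_of_forall_gt fun c hc => ?_) (le_iInf fun n => karlinOpen_mono ?_)
  swap
  · refine Set.Ioc_subset_Ioo_right ?_
    linarith [show (0 : ℝ) < 1 / ((n : ℝ) + 1) by positivity]
  -- Points with mark at most `1 / (k + 1) < c'` are harmless. Among the finitely many others, each
  -- one missing `(a, b]` already misses a slightly longer open interval, and one `n` serves them
  -- all.
  obtain ⟨c', hc', hcc'⟩ := exists_between hc
  obtain ⟨k, hk⟩ : ∃ k : ℕ, ENNReal.ofReal (1 / ((k : ℝ) + 1)) < c' := by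
    have h1 : Tendsto (fun k : ℕ => ENNReal.ofReal (1 / ((k : ℝ) + 1))) atTop (𝓝 0) := by
      simpa using ENNReal.tendsto_ofReal tendsto_one_div_add_atTop_nhds_zero_nat
    exact (h1.eventually_lt_const (pos_of_gt hc')).exists
  set S := (hfin k).toFinset with hS
  have hex : ∀ l, ∃ n : ℕ,
      ((q l).2.2 : Measure ℝ) ((fun y => (q l).2.1 * y) '' Set.Ioc a b) = 0 →
      ((q l).2.2 : Measure ℝ) ((fun y => (q l).2.1 * y) ''
        Set.Ioo a (b + 1 / ((n : ℝ) + 1))) = 0 := by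
    intro l
    by_contra! h
    exact (((q l).2.2.image_Ioc_ne_zero_iff (hpos l) a b).2 fun n => (h n).2) (h 0).1
  choose f hf using hex
  set n := S.sup f
  refine lt_of_le_of_lt ((iInf_le _ n).trans ?_) hcc'
  refine karlinOpen_le_iff.2 fun l hl => ?_
  rcases le_or_gt (karlinMark α (q l).1) (ENNReal.ofReal (1 / ((k : ℝ) + 1))) with h | h
  · exact h.trans hk.le
  have hlS : l ∈ S := by
    rw [hS, Set.Finite.mem_toFinset]
    refine ⟨hpos l, (), h, fun h0 => hl (measure_mono_null (Set.image_mono ?_) h0)⟩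
    refine Set.Ioo_subset_Ioo_right ?_
    gcongr
    rw [div_le_one (by positivity)]
    linarith [n.cast_nonneg (α := ℝ)]
  refine (karlinOpen_le_iff.1 hc'.le l fun h0 => hl (measure_mono_null (Set.image_mono ?_) (hf l h0)))
  refine Set.Ioo_subset_Ioo_right (RadonPointMeasure.antitone_add_inv b (Finset.le_sup hlS))

section

variable {Ω : Type*} [MeasurableSpace Ω] {P : Measure Ω} [IsProbabilityMeasure P]
  {α β : ℝ} {Q : Measure RadonPointMeasure} {p : ℕ → Ω → ℝ × ℝ × RadonPointMeasure}

lemma ae_forall_scale_pos (hQ : IsStandardPoissonLaw Q)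
    (hp : IsPoissonPointProcess p (karlinIntensity β Q) P) :
    ∀ᵐ ω ∂P, ∀ l, 0 < (p l ω).2.1 := by
  have := hQ.1
  have h0 : karlinIntensity β Q (Set.univ ×ˢ (Set.Iic (0 : ℝ) ×ˢ Set.univ)) = 0 := by
    rw [karlinIntensity, Measure.prod_prod, Measure.prod_prod,
      withDensity_absolutelyContinuous _ _ (s := Set.Iic (0 : ℝ)) ?_]
    · simp
    · rw [Measure.restrict_apply measurableSet_Iic]
      rw [Set.inter_comm, Set.Ioi_inter_Iic, Set.Ioc_self, measure_empty]
  filter_upwards [hp.ae_forall_notMem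
    (MeasurableSet.univ.prod (measurableSet_Iic.prod MeasurableSet.univ)) h0] with ω hω l
  simpa using hω l

lemma ae_maxIncrement_eq (hα : 0 < α) (hβ0 : 0 < β) (hβ1 : β < 1) (hQ : IsStandardPoissonLaw Q)
    (hp : IsPoissonPointProcess p (karlinIntensity β Q) P) (t : ℝ) :
    ∀ᵐ ω ∂P, maxIncrement (karlinSupMeasure α p) t ω =
      karlinOpen α (fun l => p l ω) (Set.Ioc (t - 1) t) := by
  have hfin : ∀ᵐ ω ∂P, ∀ k : ℕ, {l | p l ω ∈ karlinHitSet α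
      (fun _ : Unit => Set.Ioo (t - 1) (t + 1))
      (fun _ => ENNReal.ofReal (1 / ((k : ℝ) + 1)))}.Finite := by
    refine ae_all_iff.2 fun k => ?_
    have hJ := fun _ : Unit => RadonPointMeasure.measurableSet_image_Ioo_ne_zero (t - 1) (t + 1)
    refine hp.ae_finite (measurableSet_karlinHitSet hJ) ?_
    have hv : volume (⋃ _ : Unit, Set.Ioo (t - 1) (t + 1)) ≠ ∞ := by
      rw [Set.iUnion_const]; exact measure_Ioo_lt_top.ne
    rw [karlinIntensity_karlinHitSet_const hα hβ0 hβ1 hQ hJ (fun _ => measurableSet_Ioo)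
      hv (by positivity)]
    exact ENNReal.mul_ne_top (ENNReal.rpow_ne_top_of_nonneg hβ0.le hv) ENNReal.ofReal_ne_top
  filter_upwards [ae_forall_scale_pos hQ hp, hfin] with ω h1 h2
  exact supMeasureExtension_karlinOpen_Ioc (sub_one_lt t) h1 h2

/-- The exceptional set must not depend on `t`, so the infimum over `n` is kept: it needs only
positive scales, unlike `ae_maxIncrement_eq`, whose null set varies with `t`. -/
lemma aemeasurable_maxIncrement (hQ : IsStandardPoissonLaw Q)
    (hp : IsPoissonPointProcess p (karlinIntensity β Q) P) (s : ℝ → ℝ) :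
    AEMeasurable (fun ω (t : ℝ) => maxIncrement (karlinSupMeasure α p) (s t) ω) P := by
  classical
  refine ⟨fun ω t => ⨅ n : ℕ, ⨆ l : ℕ, if 0 < (p l ω).2.1 ∧ ((p l ω).2.2 : Measure ℝ)
    ((fun y => (p l ω).2.1 * y) '' Set.Ioo (s t - 1) (s t + 1 / ((n : ℝ) + 1))) ≠ 0
    then karlinMark α (p l ω).1 else 0, ?_, ?_⟩
  · refine measurable_pi_lambda _ fun t => Measurable.iInf fun n => Measurable.iSup fun l => ?_
    refine Measurable.ite ?_ ((measurable_karlinMark α).comp (hp.measurable l).fst)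
      measurable_const
    exact (hp.measurable l).snd (RadonPointMeasure.measurableSet_image_Ioo_ne_zero _ _)
  · filter_upwards [ae_forall_scale_pos hQ hp] with ω hω
    funext t
    simp only [hω, true_and]
    exact supMeasureExtension_Ioc (fun _ _ h => karlinOpen_mono h) (sub_one_lt (s t))

/-- Finite-dimensional distribution functions of the max-increment process. -/
lemma measure_forall_maxIncrement_le (hα : 0 < α) (hβ0 : 0 < β) (hβ1 : β < 1)
    (hQ : IsStandardPoissonLaw Q) (hp : IsPoissonPointProcess p (karlinIntensity β Q) P)
    {ι : Type*} [Countable ι] (t : ι → ℝ) (z : ι → ℝ≥0∞) :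
    P {ω | ∀ i, maxIncrement (karlinSupMeasure α p) (t i) ω ≤ z i} =
      expNeg (karlinIntensity β Q (karlinHitSet α (fun i => Set.Ioc (t i - 1) (t i)) z)) := by
  rw [← hp.measure_forall_notMem (measurableSet_karlinHitSet
    fun i => RadonPointMeasure.measurableSet_image_Ioc_ne_zero _ _)]
  refine measure_congr ?_
  filter_upwards [ae_forall_scale_pos hQ hp,
    ae_all_iff.2 fun i => ae_maxIncrement_eq hα hβ0 hβ1 hQ hp (t i)] with ω h1 h2
  refine propext ?_
  change (∀ i, _ ≤ z i) ↔ ∀ l, p l ω ∉ _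
  simp only [h2, karlinOpen_le_iff, karlinHitSet, Set.mem_ofPred_eq, h1, true_and]
  push Not
  rw [forall_comm]
  refine forall_congr' fun l => forall_congr' fun i => ?_
  rw [← not_lt]
  exact not_imp_not

lemma volume_iUnion_Ioc_add {ι : Type*} (t : ι → ℝ) (I : Set ι) (h : ℝ) :
    volume (⋃ i ∈ I, Set.Ioc (t i + h - 1) (t i + h)) =
      volume (⋃ i ∈ I, Set.Ioc (t i - 1) (t i)) := by
  rw [← measure_preimage_add_right volume h (⋃ i ∈ I, Set.Ioc (t i + h - 1) (t i + h))]
  congr 1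
  ext y
  simp only [Set.mem_preimage, Set.mem_iUnion, Set.mem_Ioc, add_le_add_iff_right, add_sub_right_comm,
    add_lt_add_iff_right]

lemma isStationaryProcess_maxIncrement (hα : 0 < α) (hβ0 : 0 < β) (hβ1 : β < 1)
    (hQ : IsStandardPoissonLaw Q) (hp : IsPoissonPointProcess p (karlinIntensity β Q) P) :
    IsStationaryProcess (maxIncrement (karlinSupMeasure α p)) P := by
  intro h
  refine (identDistrib_iff_forall_finset_identDistrib
    (X := fun t => maxIncrement (karlinSupMeasure α p) (t + h))
    (Y := maxIncrement (karlinSupMeasure α p))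
    (aemeasurable_maxIncrement hQ hp (· + h)) (aemeasurable_maxIncrement hQ hp id)).2 ?_
  intro I
  have hm1 : AEMeasurable (fun ω => I.restrict fun t =>
      maxIncrement (karlinSupMeasure α p) (t + h) ω) P :=
    (Finset.measurable_restrict I).comp_aemeasurable (aemeasurable_maxIncrement hQ hp (· + h))
  have hm2 : AEMeasurable (fun ω => I.restrict fun t =>
      maxIncrement (karlinSupMeasure α p) t ω) P :=
    (Finset.measurable_restrict I).comp_aemeasurable (aemeasurable_maxIncrement hQ hp id)
  have := Measure.isProbabilityMeasure_map hm1
  have := Measure.isProbabilityMeasure_map hm2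
  refine ⟨hm1, hm2, ?_⟩
  have hgen := generateFrom_eq_pi (ι := I) (α := fun _ => ℝ≥0∞)
    (C := fun _ => Set.range Set.Iic)
    (fun _ => (borel_eq_generateFrom_Iic ℝ≥0∞).symm.trans
      (BorelSpace.measurable_eq (α := ℝ≥0∞)).symm)
    (fun _ => ⟨fun _ => Set.univ, fun _ => ⟨⊤, Set.Iic_top⟩, Set.iUnion_const _⟩)
  -- Products of lower rays form a generating π-system, so comparing joint distribution functions
  -- suffices.
  refine ext_of_generate_finite _ hgen.symm (IsPiSystem.pi fun _ => isPiSystem_Iic) ?_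
    (by rw [measure_univ, measure_univ])
  rintro _ ⟨s, hs, rfl⟩
  choose z hz using fun i => hs i (Set.mem_univ i)
  have hs' : s = fun i => Set.Iic (z i) := funext fun i => (hz i).symm
  subst hs'
  have hms : MeasurableSet (Set.univ.pi fun i : I => Set.Iic (z i)) :=
    MeasurableSet.univ_pi fun _ => measurableSet_Iic
  refine (Measure.map_apply_of_aemeasurable hm1 hms).trans
    (Eq.trans ?_ (Measure.map_apply_of_aemeasurable hm2 hms).symm)
  -- The right-hand side does not involve `u`; the cases `u = h` and `u = 0` give the two laws.
  have key : ∀ u : ℝ, P ((fun ω => I.restrict fun t => maxIncrement (karlinSupMeasure α p) (t + u) ω) ⁻¹'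
      (Set.univ.pi fun i : I => Set.Iic (z i))) = expNeg (∫⁻ γ in Set.Ioi 0,
        volume (⋃ i ∈ {i : I | z i < karlinMark α γ}, Set.Ioc ((i : ℝ) - 1) i) ^ β) := by
    intro u
    have h1 := measure_forall_maxIncrement_le hα hβ0 hβ1 hQ hp (fun i : I => (i : ℝ) + u) z
    rw [karlinIntensity_karlinHitSet hβ0 hβ1 hQ
      (fun i => RadonPointMeasure.measurableSet_image_Ioc_ne_zero _ _) (fun _ => measurableSet_Ioc)
      ?_] at h1
    · simp only [← volume_iUnion_Ioc_add (fun i : I => (i : ℝ)) _ u]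
      refine Eq.trans ?_ h1
      congr 1
      ext ω
      simp only [Set.mem_preimage, Set.mem_univ_pi, Set.mem_Iic, Set.mem_ofPred_eq,
        Finset.restrict]
    · refine ((measure_iUnion_le _).trans_lt ?_).ne
      simp
  have k1 := key h
  have k2 := key 0
  simp only [add_zero] at k2
  exact k1.trans k2.symm

end

/-! ### A correlation criterion for non-ergodicity -/

section

open scoped InnerProductSpace

variable {H : Type*} [NormedAddCommGroup H] [InnerProductSpace ℝ H]

lemma convex_halfSpace_inner_ge (x : H) (r : ℝ) : Convex ℝ {y | r ≤ ⟪x, y⟫_ℝ} :=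
  convex_halfSpace_ge (innerₛₗ ℝ x).isLinear r

lemma closedConvexHull_range_subset_inner_ge {ι : Type*} {v : ι → H} {x : H} {r : ℝ}
    (h : ∀ i, r ≤ ⟪x, v i⟫_ℝ) {y : H} (hy : y ∈ closure (convexHull ℝ (Set.range v))) :
    r ≤ ⟪x, y⟫_ℝ := by
  have h1 : convexHull ℝ (Set.range v) ⊆ {y | r ≤ ⟪x, y⟫_ℝ} :=
    convexHull_min (by rintro _ ⟨i, rfl⟩; exact h i) (convex_halfSpace_inner_ge x r)
  exact closure_minimal h1 (isClosed_le (by fun_prop) (by fun_prop)) hy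

/-- The element of minimal norm of the closed convex hull of an orbit is a fixed vector. -/
lemma exists_fixed_mem_closure_convexHull [CompleteSpace H] {ι κ : Type*} [Nonempty ι]
    (v : ι → H) (U : κ → H →ₗᵢ[ℝ] H) (σ : κ → ι → ι) (hU : ∀ k i, U k (v i) = v (σ k i)) :
    ∃ x ∈ closure (convexHull ℝ (Set.range v)), ∀ k, U k x = x := by
  set K := closure (convexHull ℝ (Set.range v)) with hK
  have hconv : Convex ℝ K := (convex_convexHull ℝ _).closure
  have hne : K.Nonempty := ((Set.range_nonempty v).mono (subset_convexHull ℝ _)).mono subset_closure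
  obtain ⟨x, hx, hmin⟩ := exists_norm_eq_iInf_of_complete_convex hne isClosed_closure.isComplete
    hconv 0
  rw [norm_eq_iInf_iff_real_inner_le_zero hconv hx] at hmin
  refine ⟨x, hx, fun k => ?_⟩
  have hmem : U k x ∈ K := by
    have h1 : Set.MapsTo (U k) (convexHull ℝ (Set.range v)) (convexHull ℝ (Set.range v)) := by
      intro y hy
      have h2 : U k y ∈ (U k).toLinearMap '' convexHull ℝ (Set.range v) := ⟨y, hy, rfl⟩
      rw [LinearMap.image_convexHull] at h2
      refine convexHull_mono ?_ h2
      rintro _ ⟨_, ⟨i, rfl⟩, rfl⟩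
      exact ⟨σ k i, (hU k i).symm⟩
    exact h1.closure (U k).continuous hx
  -- Minimality gives `⟪x, U x⟫ ≥ ‖x‖²`, hence `‖U x - x‖² = 2‖x‖² - 2⟪x, U x⟫ ≤ 0`.
  have h3 := hmin _ hmem
  rw [zero_sub, inner_neg_left, inner_sub_right, real_inner_self_eq_norm_sq] at h3
  have h4 := norm_sub_sq_real (U k x) x
  rw [(U k).norm_map, real_inner_comm] at h4
  rw [← sub_eq_zero, ← norm_eq_zero]
  nlinarith [norm_nonneg (U k x - x)]

end

section

variable {Ω S : Type*} [MeasurableSpace Ω] [MeasurableSpace S] {X : ℝ → Ω → S} {P : Measure Ω}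

/-- The time shift on path space. -/
def pathShift (S : Type*) (h : ℝ) (f : ℝ → S) (t : ℝ) : S := f (t + h)

lemma measurable_pathShift (h : ℝ) : Measurable (pathShift S h) :=
  measurable_pi_lambda _ fun t => measurable_pi_apply (t + h)

lemma IsStationaryProcess.aemeasurable (hX : IsStationaryProcess X P) :
    AEMeasurable (fun ω t => X t ω) P := (hX 0).aemeasurable_snd

lemma IsStationaryProcess.measurePreserving (hX : IsStationaryProcess X P) (h : ℝ) :
    MeasurePreserving (pathShift S h) (P.map fun ω t => X t ω) (P.map fun ω t => X t ω) := by
  refine ⟨measurable_pathShift h, ?_⟩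
  rw [AEMeasurable.map_map_of_aemeasurable (measurable_pathShift h).aemeasurable hX.aemeasurable]
  exact (hX h).map_eq

/-- Shift-invariant functions of an ergodic process are almost surely constant. -/
lemma IsErgodicProcess.exists_ae_eq_const [IsProbabilityMeasure P] (hX : IsStationaryProcess X P)
    (he : IsErgodicProcess X P) {F : (ℝ → S) → ℝ} (hF : Measurable F)
    (hinv : ∀ h, F ∘ pathShift S h =ᵐ[P.map fun ω t => X t ω] F) :
    ∃ c : ℝ, F =ᵐ[P.map fun ω t => X t ω] fun _ => c := by
  have hm := hX.aemeasurable
  have := Measure.isProbabilityMeasure_map hm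
  -- It is enough that every measurable `U` has a preimage of full or zero measure, since countably
  -- many such sets separate the points of `ℝ`.
  refine exists_eventuallyEq_const_of_forall_separating MeasurableSet fun U hU => ?_
  have hA : MeasurableSet (F ⁻¹' U) := hF hU
  have h01 := he (F ⁻¹' U) hA fun h => by
    refine measure_mono_null ?_ (ae_of_ae_map hm (hinv h))
    intro ω hω hω'
    have h1 : F (fun t => X (t + h) ω) = F fun t => X t ω := hω'
    simp only [Set.mem_symmDiff, Set.mem_ofPred_eq, Set.mem_preimage, h1] at hω
    tauto
  have hmap : P.map (fun ω t => X t ω) (F ⁻¹' U) = P {ω | (fun t => X t ω) ∈ F ⁻¹' U} :=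
    Measure.map_apply_of_aemeasurable hm hA
  rw [← hmap] at h01
  rcases h01 with h0 | h1
  · exact Or.inr (measure_eq_zero_iff_ae_notMem.1 h0)
  · exact Or.inl ((mem_ae_iff_prob_eq_one hA).2 h1)

/-- A stationary process, for which the events `X s ∈ B`, `X t ∈ B` are uniformly positively
correlated, is not ergodic. -/
lemma IsStationaryProcess.not_ergodic_of_le_correlation [IsProbabilityMeasure P]
    (hX : IsStationaryProcess X P) {B : Set S} (hB : MeasurableSet B) {r : ℝ}
    (hr : ∀ s t, r ≤ P.real {ω | X s ω ∈ B ∧ X t ω ∈ B})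
    (hlt : P.real {ω | X 0 ω ∈ B} ^ 2 < r) : ¬ IsErgodicProcess X P := by
  intro he
  have hm := hX.aemeasurable
  have hν := Measure.isProbabilityMeasure_map hm
  set ν := P.map fun ω t => X t ω with hνdef
  have hE : ∀ t : ℝ, MeasurableSet {f : ℝ → S | f t ∈ B} := fun t => measurable_pi_apply t hB
  have hreal : ∀ {A : Set (ℝ → S)}, MeasurableSet A →
      ν.real A = P.real {ω | (fun t => X t ω) ∈ A} := fun {A} hA => by
    rw [Measure.real, hνdef, Measure.map_apply_of_aemeasurable hm hA]; rfl
  set v : ℝ → Lp ℝ 2 ν := fun t => indicatorConstLp 2 (hE t) (measure_ne_top ν _) 1 with hv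
  set e : Lp ℝ 2 ν := indicatorConstLp 2 MeasurableSet.univ (measure_ne_top ν _) 1 with he'
  obtain ⟨x, hx, hfix⟩ := exists_fixed_mem_closure_convexHull v
    (fun h : ℝ => Lp.compMeasurePreservingₗᵢ ℝ (pathShift S h) (hX.measurePreserving h))
    (fun h t => t + h) (fun h t => rfl)
  have hvv : ∀ s t, r ≤ inner ℝ (v s) (v t) := fun s t => by
    rw [hv, L2.real_inner_indicatorConstLp_one_indicatorConstLp_one (hE s) (hE t),
      hreal ((hE s).inter (hE t))]
    exact hr s t
  have hxx : r ≤ inner ℝ x x := by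
    -- The bound on `⟪v s, v t⟫` passes to the hull one argument at a time.
    refine closedConvexHull_range_subset_inner_ge (fun t => ?_) hx
    rw [real_inner_comm]
    exact closedConvexHull_range_subset_inner_ge (hvv t) hx
  have hev : ∀ t, inner ℝ e (v t) = P.real {ω | X 0 ω ∈ B} := fun t => by
    have h0 : pathShift S t ⁻¹' {f | f 0 ∈ B} = {f : ℝ → S | f t ∈ B} := by
      ext f; simp [pathShift]
    rw [hv, he', L2.real_inner_indicatorConstLp_one_indicatorConstLp_one MeasurableSet.univ (hE t),
      Set.univ_inter, ← h0, Measure.real,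
      (hX.measurePreserving t).measure_preimage (hE 0).nullMeasurableSet]
    exact hreal (hE 0)
  have hex : inner ℝ e x = P.real {ω | X 0 ω ∈ B} := by
    refine le_antisymm ?_ (closedConvexHull_range_subset_inner_ge (fun t => (hev t).ge) hx)
    -- Pairing with the constant function `1` is constant along the orbit; the half-spaces for `e`
    -- and `-e` together give equality on the hull.
    have := closedConvexHull_range_subset_inner_ge (x := -e) (r := -P.real {ω | X 0 ω ∈ B})
      (fun t => by rw [inner_neg_left, hev t]) hx
    rw [inner_neg_left] at this
    linarith
  obtain ⟨c, hc⟩ := he.exists_ae_eq_const hX (Lp.stronglyMeasurable x).measurable fun h => by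
    have h1 := Lp.coeFn_compMeasurePreserving x (hX.measurePreserving h)
    have h2 : Lp.compMeasurePreserving (pathShift S h) (hX.measurePreserving h) x = x := hfix h
    rw [h2] at h1
    exact h1.symm
  -- If `x` is a constant `c`, its mean is `c` and its squared norm `c ^ 2`, which is incompatible
  -- with `hxx` and `hlt`.
  have hex' : inner ℝ e x = c := by
    rw [he', L2.inner_indicatorConstLp_one, Measure.restrict_univ, integral_congr_ae hc]
    simp
  have hxx' : inner ℝ x x = c ^ 2 := by
    rw [L2.inner_def, integral_congr_ae (g := fun _ => c ^ 2)]
    · simp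
    · filter_upwards [hc] with f hf
      simp [hf, sq]
  rw [← hex, hex', ← hxx'] at hlt
  exact absurd hxx (not_le.2 hlt)

end

/-! ### Bivariate distributions and the main theorem -/

section

variable {Ω : Type*} [MeasurableSpace Ω] {P : Measure Ω} [IsProbabilityMeasure P]
  {α β : ℝ} {Q : Measure RadonPointMeasure} {p : ℕ → Ω → ℝ × ℝ × RadonPointMeasure}

lemma measureReal_maxIncrement_le_and_le (hα : 0 < α) (hβ0 : 0 < β) (hβ1 : β < 1)
    (hQ : IsStandardPoissonLaw Q) (hp : IsPoissonPointProcess p (karlinIntensity β Q) P)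
    {z : ℝ} (hz : 0 < z) (s t : ℝ) :
    P.real {ω | maxIncrement (karlinSupMeasure α p) s ω ≤ ENNReal.ofReal z ∧
      maxIncrement (karlinSupMeasure α p) t ω ≤ ENNReal.ofReal z} =
    Real.exp (-(volume.real (Set.Ioc (s - 1) s ∪ Set.Ioc (t - 1) t) ^ β * z ^ (-α))) := by
  have hU : ⋃ i, Set.Ioc (![s, t] i - 1) (![s, t] i) = Set.Ioc (s - 1) s ∪ Set.Ioc (t - 1) t := by
    ext y; simp [Fin.exists_fin_two]
  have hfin : volume (Set.Ioc (s - 1) s ∪ Set.Ioc (t - 1) t) ≠ ∞ :=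
    (measure_union_lt_top measure_Ioc_lt_top measure_Ioc_lt_top).ne
  have h := measure_forall_maxIncrement_le hα hβ0 hβ1 hQ hp ![s, t]
    (fun _ => ENNReal.ofReal z)
  rw [karlinIntensity_karlinHitSet_const hα hβ0 hβ1 hQ
    (fun i => RadonPointMeasure.measurableSet_image_Ioc_ne_zero _ _) (fun _ => measurableSet_Ioc)
    (by rwa [hU]) hz, hU, ← ofReal_measureReal hfin,
    ENNReal.ofReal_rpow_of_nonneg measureReal_nonneg hβ0.le, ← ENNReal.ofReal_mul (by positivity),
    expNeg_ofReal (by positivity)] at h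
  rw [← ENNReal.toReal_ofReal (Real.exp_nonneg _), ← h, Measure.real]
  congr 2
  ext ω
  simp [Fin.forall_fin_two]

lemma measureReal_maxIncrement_le (hα : 0 < α) (hβ0 : 0 < β) (hβ1 : β < 1)
    (hQ : IsStandardPoissonLaw Q) (hp : IsPoissonPointProcess p (karlinIntensity β Q) P)
    {z : ℝ} (hz : 0 < z) (t : ℝ) :
    P.real {ω | maxIncrement (karlinSupMeasure α p) t ω ≤ ENNReal.ofReal z} =
      Real.exp (-z ^ (-α)) := by
  have h := measureReal_maxIncrement_le_and_le hα hβ0 hβ1 hQ hp hz t t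
  simpa using h

/-- The range `t ≤ 1`, where the intervals overlap or touch, is needed for the integrability of
`τ_z` near `0`. -/
lemma volumeReal_union_Ioc {t : ℝ} (ht : 0 ≤ t) :
    volume.real (Set.Ioc ((0 : ℝ) - 1) 0 ∪ Set.Ioc (t - 1) t) = 1 + min t 1 := by
  rcases le_total t 1 with h | h
  · rw [Set.Ioc_union_Ioc' (by linarith) (by linarith), Real.volume_real_Ioc, min_eq_left h,
      min_eq_left (by linarith), max_eq_right ht, max_eq_left (by linarith)]
    ring
  · rw [measureReal_union (Set.Ioc_disjoint_Ioc_of_le (by linarith)) measurableSet_Ioc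
      measure_Ioc_lt_top.ne measure_Ioc_lt_top.ne,
      min_eq_right h]
    simp

lemma bivariateDependence_maxIncrement (hα : 0 < α) (hβ0 : 0 < β) (hβ1 : β < 1)
    (hQ : IsStandardPoissonLaw Q) (hp : IsPoissonPointProcess p (karlinIntensity β Q) P)
    {z : ℝ} (hz : 0 < z) {t : ℝ} (ht : 0 ≤ t) :
    bivariateDependence (maxIncrement (karlinSupMeasure α p)) P z t =
      (2 - (1 + min t 1) ^ β) * z ^ (-α) := by
  rw [bivariateDependence, measureReal_maxIncrement_le_and_le hα hβ0 hβ1 hQ hp hz,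
    measureReal_maxIncrement_le hα hβ0 hβ1 hQ hp hz, Real.log_exp, Real.log_exp,
    volumeReal_union_Ioc ht]
  ring

lemma not_isErgodicProcess_maxIncrement (hα : 0 < α) (hβ0 : 0 < β) (hβ1 : β < 1)
    (hQ : IsStandardPoissonLaw Q) (hp : IsPoissonPointProcess p (karlinIntensity β Q) P) :
    ¬ IsErgodicProcess (maxIncrement (karlinSupMeasure α p)) P := by
  refine (isStationaryProcess_maxIncrement hα hβ0 hβ1 hQ hp).not_ergodic_of_le_correlation
    -- At level `1` the factor `z ^ (-α)` disappears, and `r` is the joint probability for disjoint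
    -- unit intervals, the smallest possible. It exceeds `exp (-2)` because `β < 1`.
    (measurableSet_Iic (a := ENNReal.ofReal 1)) (r := Real.exp (-(2 : ℝ) ^ β)) (fun s t => ?_) ?_
  · have h := measureReal_maxIncrement_le_and_le hα hβ0 hβ1 hQ hp one_pos s t
    rw [Real.one_rpow, mul_one] at h
    simp only [Set.mem_Iic]
    rw [h, Real.exp_le_exp, neg_le_neg_iff]
    refine Real.rpow_le_rpow measureReal_nonneg ?_ hβ0.le
    refine (measureReal_union_le _ _).trans ?_
    norm_num
  · have h := measureReal_maxIncrement_le hα hβ0 hβ1 hQ hp one_pos 0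
    rw [Real.one_rpow] at h
    simp only [Set.mem_Iic]
    rw [h, ← Real.exp_nat_mul, Real.exp_lt_exp]
    have : (2 : ℝ) ^ β < 2 ^ (1 : ℝ) := Real.rpow_lt_rpow_of_exponent_lt (by norm_num) hβ1
    rw [Real.rpow_one] at this
    push_cast
    linarith

end

/-- The time averages of a function which is eventually constant converge to that constant. -/
lemma tendsto_average_of_eq_const {f : ℝ → ℝ} {a c : ℝ} (hf : IntervalIntegrable f volume 0 a)
    (hc : ∀ t, a < t → f t = c) :
    Tendsto (fun T : ℝ => (1 / T) * ∫ t in (0 : ℝ)..T, f t) atTop (𝓝 c) := by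
  -- For `T > max a 0` the average equals this expression exactly.
  have h1 : Tendsto (fun T : ℝ => T⁻¹ * ((∫ t in (0 : ℝ)..a, f t) - a * c) + c) atTop (𝓝 c) := by
    simpa using (tendsto_inv_atTop_zero.mul_const ((∫ t in (0 : ℝ)..a, f t) - a * c)).add_const c
  refine h1.congr' ?_
  filter_upwards [eventually_gt_atTop a, eventually_gt_atTop 0] with T hT hT0
  have h2 : Set.EqOn f (fun _ => c) (Set.uIoc a T) := fun t ht => by
    rw [Set.uIoc_of_le hT.le] at ht
    exact hc t ht.1
  rw [← intervalIntegral.integral_add_adjacent_intervals hf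
    ((intervalIntegrable_congr h2).2 intervalIntegrable_const),
    intervalIntegral.integral_congr_ae (g := fun _ => c) (ae_of_all _ h2),
    intervalIntegral.integral_const]
  field_simp
  simp only [smul_eq_mul]
  ring

theorem mainTheorem4 {Ω : Type*} [MeasurableSpace Ω] (P : Measure Ω) [IsProbabilityMeasure P]
    (α β : ℝ) (hα : 0 < α) (hβ0 : 0 < β) (hβ1 : β < 1)
    (Q : Measure RadonPointMeasure) (hQ : IsStandardPoissonLaw Q)
    (p : ℕ → Ω → ℝ × ℝ × RadonPointMeasure)
    (hp : IsPoissonPointProcess p (karlinIntensity β Q) P) :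
    IsStationaryProcess (maxIncrement (karlinSupMeasure α p)) P ∧
    ¬ IsErgodicProcess (maxIncrement (karlinSupMeasure α p)) P ∧
    ∀ z : ℝ, 0 < z →
      (∀ t : ℝ, 1 < t →
        bivariateDependence (maxIncrement (karlinSupMeasure α p)) P z t =
          (2 - (2 : ℝ) ^ β) * z ^ (-α)) ∧
      Tendsto (fun T : ℝ => (1 / T) *
          ∫ t in (0 : ℝ)..T, bivariateDependence (maxIncrement (karlinSupMeasure α p)) P z t)
        atTop (𝓝 ((2 - (2 : ℝ) ^ β) * z ^ (-α))) ∧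
      (2 - (2 : ℝ) ^ β) * z ^ (-α) ≠ 0 := by
  refine ⟨isStationaryProcess_maxIncrement hα hβ0 hβ1 hQ hp,
    not_isErgodicProcess_maxIncrement hα hβ0 hβ1 hQ hp, fun z hz => ?_⟩
  have hτ : ∀ t : ℝ, 1 < t →
      bivariateDependence (maxIncrement (karlinSupMeasure α p)) P z t =
        (2 - (2 : ℝ) ^ β) * z ^ (-α) := fun t ht => by
    rw [bivariateDependence_maxIncrement hα hβ0 hβ1 hQ hp hz (by linarith), min_eq_right ht.le,
      one_add_one_eq_two]
  refine ⟨hτ, tendsto_average_of_eq_const (a := 1) ?_ hτ, ?_⟩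
  · have hc : Continuous fun t : ℝ => (2 - (1 + min t 1) ^ β) * z ^ (-α) :=
      (continuous_const.sub ((by fun_prop : Continuous fun t : ℝ => 1 + min t 1).rpow_const
        fun _ => Or.inr hβ0.le)).mul continuous_const
    refine (intervalIntegrable_congr fun t ht => ?_).2 (hc.intervalIntegrable 0 1)
    rw [Set.uIoc_of_le zero_le_one] at ht
    exact bivariateDependence_maxIncrement hα hβ0 hβ1 hQ hp hz ht.1.le
  · have : (2 : ℝ) ^ β < 2 ^ (1 : ℝ) := Real.rpow_lt_rpow_of_exponent_lt (by norm_num) hβ1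
    rw [Real.rpow_one] at this
    exact mul_ne_zero (sub_ne_zero.2 this.ne') (by positivity)
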